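/- Let $F$ be a field with prime field $P(F)$ (its smallest subfield), let $M=(m_1,m_2)\in F^2$ and $r\in F\setminus\{0\}$, and let $$C(M,r)_F=\{(x,y)\in F^2 : (x-m_1)^2+(y-m_2)^2=r^2\}.$$ For $A=(a_1,a_2)$ and $B=(b_1,b_2)$ in $F^2$ put $D^2(A,B)=(a_1-b_1)^2+(a_2-b_2)^2$. A \emph{circular point set} on $C(M,r)_F$ is a set $S\subseteq C(M,r)_F$ such that for all $A,B\in S$ the element $D^2(A,B)$ is the square of an element of $P(F)$ (zero is allowed). It is \emph{e-maximal} if no point of $C(M,r)_F\setminus S$ can be added to $S$ so that the result is still a circular point set, and \emph{c-maximal} if it is e-maximal and has maximal cardinality among all e-maximal circular point sets on $C(M,r)_F$. Then c-maximal circular point sets on $C(M,r)_F$ exist, and every such set $S$ has the following cardinality. 1. If $\operatorname{char}F=2$, then $|S|=|F|$ (for every $r \neq 0$). 2. If $\operatorname{char}F=3$, then $|S|=2$ if $r^2\in P(F)$ (both when $r\in P(F)$ and when $r\notin P(F)$), and $|S|\le 2$ if $r^2\notin P(F)$. 3. If $\operatorname{char}F=p>3$ and there is no $t\in P(F)$ with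 $t^2+1=0$, then $|S|=\frac{p+1}{2}$ if $r\in P(F)$; $|S|=\frac{p-1}{2}$ if $r^2\in P(F)$ but $r\notin P(F)$; and $|S|\le 2$ if $r^2\notin P(F)$. 4. If $\operatorname{char}F=p>3$ and there is $t\in P(F)$ with $t^2+1=0$, then $|S|=\frac{p-1}{2}$ if $r\in P(F)$; $|S|=\frac{p+1}{2}$ if $r^2\in P(F)$ but $r\notin P(F)$; and $|S|\le 2$ if $r^2\notin P(F)$. 5. If $\operatorname{char}F=0$, then $|S|=\aleph_0$ if $r^2\in P(F)$ (both when $r\in P(F)$ and when $r\notin P(F)$), and $|S|\le 2$ if $r^2\notin P(F)$. -/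

import Mathlib

/-- The prime field `P(F)` of a field `F`, i.e. its smallest subfield. -/
def primeField (F : Type*) [Field F] : Subfield F := ⊥

/-- The squared distance `D²(A, B)` of two points of the affine plane `F × F`. -/
def sqDist {F : Type*} [Field F] (A B : F × F) : F :=
  (A.1 - B.1) ^ 2 + (A.2 - B.2) ^ 2

/-- The circle `C(M, r)` in the affine plane `F × F`. -/
def circleSet {F : Type*} [Field F] (M : F × F) (r : F) : Set (F × F) :=
  {A | (A.1 - M.1) ^ 2 + (A.2 - M.2) ^ 2 = r ^ 2}

/-- `A` and `B` have rational squared distance: `D²(A, B)` has a square root in the prime field. -/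
def HasRationalSqDist {F : Type*} [Field F] (A B : F × F) : Prop :=
  ∃ s ∈ primeField F, sqDist A B = s ^ 2

/-- A rational point set: any two points have rational squared distance. -/
def IsRationalPointSet {F : Type*} [Field F] (S : Set (F × F)) : Prop :=
  ∀ A ∈ S, ∀ B ∈ S, HasRationalSqDist A B

/-- A circular point set on `C(M, r)`: a rational point set contained in the circle. -/
def IsCircularPointSet {F : Type*} [Field F] (M : F × F) (r : F) (S : Set (F × F)) : Prop :=
  IsRationalPointSet S ∧ S ⊆ circleSet M r

/-- `S` is e-maximal with respect to `C(M, r)`: it is a circular point set that cannot be extended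
by any further point of the circle. -/
def IsEMaximal {F : Type*} [Field F] (M : F × F) (r : F) (S : Set (F × F)) : Prop :=
  IsCircularPointSet M r S ∧
    ∀ A ∈ circleSet M r, A ∉ S → ¬ IsCircularPointSet M r (insert A S)

/-- `S` is c-maximal with respect to `C(M, r)`: it is e-maximal, of maximal cardinality among
all e-maximal sets. -/
def IsCMaximal {F : Type*} [Field F] (M : F × F) (r : F) (S : Set (F × F)) : Prop :=
  IsEMaximal M r S ∧ ∀ T : Set (F × F), IsEMaximal M r T → Cardinal.mk T ≤ Cardinal.mk S

/-! In characteristic 2 the circle is a line and all squared distances on it vanish, so the whole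
circle is a circular point set.

Otherwise project from a point `A` of the set. The other points of the circle are `stereo M A q`
with `q ^ 2 + 1 ≠ 0`, and the distance to `A` is rational iff `1 + q ^ 2 = r ^ 2 * m ^ 2` with `m ≠
0` in the prime field `P`. For two such points, rational mutual distance puts `q - q'` in `r * P`;
as `q ^ 2 - q' ^ 2` lies in `r ^ 2 * P`, also `q` lies in `r * P`. Hence a set with three points
lies in `slopeSet M A r`, which is itself circular, and `r ^ 2 ∈ P`
(`IsCircularPointSet.card_le_two_or_subset`, `isCircularPointSet_slopeSet`).

The size of `slopeSet` comes from the hyperbola `n ^ 2 + r⁻² = m ^ 2` over `P`: with `u = m + n`,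
the map `u ↦ n` is two-to-one. If `P` has `p` elements this gives `(p - χ(-r²)) / 2` points
including `A`, with `χ` the quadratic character (`two_mul_card_add_eq`); in characteristic 0 it
gives countably infinitely many. -/

theorem mem_circleSet {F : Type*} [Field F] {M A : F × F} {r : F} :
    A ∈ circleSet M r ↔ (A.1 - M.1) ^ 2 + (A.2 - M.2) ^ 2 = r ^ 2 := Iff.rfl

theorem sqDist_comm {F : Type*} [Field F] (A B : F × F) : sqDist A B = sqDist B A := by
  unfold sqDist; ring

theorem HasRationalSqDist.symm {F : Type*} [Field F] {A B : F × F}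
    (h : HasRationalSqDist A B) : HasRationalSqDist B A := by
  rwa [HasRationalSqDist, sqDist_comm]

theorem HasRationalSqDist.refl {F : Type*} [Field F] (A : F × F) : HasRationalSqDist A A :=
  ⟨0, zero_mem _, by simp [sqDist]⟩

theorem IsRationalPointSet.insert {F : Type*} [Field F] {S : Set (F × F)} {A : F × F}
    (hS : IsRationalPointSet S) (hA : ∀ B ∈ S, HasRationalSqDist A B) :
    IsRationalPointSet (insert A S) := by
  rintro B (rfl | hB) C (rfl | hC)
  · exact .refl _
  · exact hA C hC
  · exact (hA B hB).symm
  · exact hS B hB C hC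

theorem isCircularPointSet_singleton {F : Type*} [Field F] {M A : F × F} {r : F}
    (hA : A ∈ circleSet M r) : IsCircularPointSet M r {A} :=
  ⟨by rintro B rfl C rfl; exact .refl _, by simpa using hA⟩

theorem base_mem_circleSet {F : Type*} [Field F] (M : F × F) (r : F) :
    (M.1 + r, M.2) ∈ circleSet M r := by
  simp [mem_circleSet]

/-- The point of the circle around `M` through `A` seen from `A` under half the central angle with
cotangent `q`. -/
def stereo {F : Type*} [Field F] (M A : F × F) (q : F) : F × F :=
  (M.1 + ((A.1 - M.1) * (q ^ 2 - 1) - (A.2 - M.2) * (2 * q)) / (q ^ 2 + 1),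
   M.2 + ((A.2 - M.2) * (q ^ 2 - 1) + (A.1 - M.1) * (2 * q)) / (q ^ 2 + 1))

/-! ### Stereographic parametrization of the circle -/

section Stereo

variable {F : Type*} [Field F] {M A : F × F} {r : F}

theorem stereo_mem_circleSet (hA : A ∈ circleSet M r) {q : F} (hq : q ^ 2 + 1 ≠ 0) :
    stereo M A q ∈ circleSet M r := by
  rw [mem_circleSet] at hA ⊢
  rw [← hA]
  simp only [stereo]
  field_simp
  ring

theorem sqDist_stereo (hA : A ∈ circleSet M r) {q : F} (hq : q ^ 2 + 1 ≠ 0) :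
    sqDist A (stereo M A q) = 4 * r ^ 2 / (q ^ 2 + 1) := by
  rw [mem_circleSet] at hA
  rw [← hA]
  simp only [stereo, sqDist]
  field_simp
  ring

theorem sqDist_stereo_stereo (hA : A ∈ circleSet M r) {q q' : F} (hq : q ^ 2 + 1 ≠ 0)
    (hq' : q' ^ 2 + 1 ≠ 0) :
    sqDist (stereo M A q) (stereo M A q') =
      4 * r ^ 2 * (q - q') ^ 2 / ((q ^ 2 + 1) * (q' ^ 2 + 1)) := by
  rw [mem_circleSet] at hA
  rw [← hA]
  simp only [stereo, sqDist]
  field_simp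
  ring

theorem exists_eq_stereo (h2 : (2 : F) ≠ 0) (hr : r ≠ 0) (hA : A ∈ circleSet M r) {B : F × F}
    (hB : B ∈ circleSet M r) (hBA : B ≠ A) : ∃ q : F, q ^ 2 + 1 ≠ 0 ∧ B = stereo M A q := by
  obtain ⟨m, n⟩ := M
  obtain ⟨a, b⟩ := A
  obtain ⟨x, y⟩ := B
  simp only [mem_circleSet] at hA hB
  obtain ⟨a, rfl⟩ : ∃ a', a = m + a' := ⟨a - m, by ring⟩
  obtain ⟨b, rfl⟩ : ∃ b', b = n + b' := ⟨b - n, by ring⟩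
  obtain ⟨x, rfl⟩ : ∃ x', x = m + x' := ⟨x - m, by ring⟩
  obtain ⟨y, rfl⟩ : ∃ y', y = n + y' := ⟨y - n, by ring⟩
  simp only [add_sub_cancel_left] at hA hB
  have hr2 : r ^ 2 ≠ 0 := pow_ne_zero 2 hr
  have hid : (a * x + b * y) ^ 2 + (a * y - b * x) ^ 2 = r ^ 2 * r ^ 2 := by
    linear_combination r ^ 2 * hB + (x ^ 2 + y ^ 2) * hA
  -- The parameter is `sin θ / (1 - cos θ)`, the cotangent of half the central angle; its
  -- denominator vanishes only at `A`, even when isotropic vectors exist.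
  have hD : r ^ 2 - (a * x + b * y) ≠ 0 := by
    intro h
    have hc : a * y - b * x = 0 := by
      rw [← sq_eq_zero_iff]
      linear_combination hid + (r ^ 2 + (a * x + b * y)) * h
    apply hBA
    have h1 : x = a := by
      apply mul_left_cancel₀ hr2
      linear_combination (-x) * hA - a * h - b * hc
    have h3 : y = b := by
      apply mul_left_cancel₀ hr2
      linear_combination (-y) * hA - b * h + a * hc
    rw [h1, h3]
  set D := r ^ 2 - (a * x + b * y) with hDdef
  have hq : ((a * y - b * x) / D) ^ 2 + 1 = 2 * r ^ 2 / D := by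
    field_simp
    rw [hDdef]
    linear_combination hid
  refine ⟨(a * y - b * x) / D, ?_, ?_⟩
  · rw [hq]
    exact div_ne_zero (mul_ne_zero h2 hr2) hD
  · have hq' : ((a * y - b * x) / D) ^ 2 - 1 = 2 * r ^ 2 / D - 2 := by
      linear_combination hq
    simp only [stereo, add_sub_cancel_left]
    rw [hq, hq']
    congr 2
    · field_simp
      rw [hDdef]
      linear_combination (-x) * hA
    · field_simp
      rw [hDdef]
      linear_combination (-y) * hA

end Stereo

/-! ### Circular sets with three points and rational slopes -/

section Structure

variable {F : Type*} [Field F] {M A : F × F} {r : F}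

/-- The elements `n` of the prime field for which `r⁻² + n²` is a nonzero square of the prime
field. -/
def rationalSlopes (r : F) : Set (primeField F) :=
  {n | ∃ m : primeField F, m ≠ 0 ∧ 1 + r ^ 2 * (n : F) ^ 2 = r ^ 2 * (m : F) ^ 2}

/-- The point `A` together with all points of rational slope as seen from `A`. -/
def slopeSet (M A : F × F) (r : F) : Set (F × F) :=
  insert A ((fun n : primeField F => stereo M A (r * n)) '' rationalSlopes r)

theorem exists_of_hasRationalSqDist_stereo (h2 : (2 : F) ≠ 0) (hr : r ≠ 0)
    (hA : A ∈ circleSet M r) {q : F} (hq : q ^ 2 + 1 ≠ 0)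
    (h : HasRationalSqDist A (stereo M A q)) :
    ∃ m ∈ primeField F, m ≠ 0 ∧ 1 + q ^ 2 = r ^ 2 * m ^ 2 := by
  obtain ⟨s, hs, h⟩ := h
  rw [sqDist_stereo hA hq, div_eq_iff hq] at h
  have h4 : (4 : F) * r ^ 2 ≠ 0 := by
    rw [show (4 : F) = 2 * 2 by norm_num]
    exact mul_ne_zero (mul_ne_zero h2 h2) (pow_ne_zero 2 hr)
  have hs0 : s ≠ 0 := by
    rintro rfl
    apply h4
    rw [h]; ring
  refine ⟨2 / s, div_mem (ofNat_mem _ 2) hs, div_ne_zero h2 hs0, ?_⟩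
  field_simp
  linear_combination -h

theorem hasRationalSqDist_stereo (h2 : (2 : F) ≠ 0) (hr : r ≠ 0)
    (hA : A ∈ circleSet M r) {q m : F} (hm : m ∈ primeField F) (hm0 : m ≠ 0)
    (h : 1 + q ^ 2 = r ^ 2 * m ^ 2) :
    stereo M A q ∈ circleSet M r ∧ HasRationalSqDist A (stereo M A q) ∧ stereo M A q ≠ A := by
  have hq1 : q ^ 2 + 1 = r ^ 2 * m ^ 2 := by rw [← h, add_comm]
  have hq : q ^ 2 + 1 ≠ 0 := by
    rw [hq1]
    exact mul_ne_zero (pow_ne_zero 2 hr) (pow_ne_zero 2 hm0)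
  have hd : sqDist A (stereo M A q) = (2 / m) ^ 2 := by
    rw [sqDist_stereo hA hq, hq1]
    field_simp
    norm_num
  refine ⟨stereo_mem_circleSet hA hq, ⟨2 / m, div_mem (ofNat_mem _ 2) hm, hd⟩, fun hc => ?_⟩
  rw [hc] at hd
  have : (2 / m) ^ 2 = 0 := by
    rw [← hd, sqDist]; ring
  exact pow_ne_zero 2 (div_ne_zero h2 hm0) this

/-- Both `q - q'` and `q + q' = (q ^ 2 - q' ^ 2) / (q - q')` are `r` times an element of the prime
field, so their half sum is too. -/
theorem exists_slope_of_hasRationalSqDist (h2 : (2 : F) ≠ 0) (hr : r ≠ 0)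
    (hA : A ∈ circleSet M r) {q q' m m' : F} (hqq : q ≠ q') (hm : m ∈ primeField F) (hm0 : m ≠ 0)
    (hq : 1 + q ^ 2 = r ^ 2 * m ^ 2) (hm' : m' ∈ primeField F) (hm0' : m' ≠ 0)
    (hq' : 1 + q' ^ 2 = r ^ 2 * m' ^ 2)
    (h : HasRationalSqDist (stereo M A q) (stereo M A q')) :
    ∃ n ∈ primeField F, q = r * n := by
  have hq1 : q ^ 2 + 1 = r ^ 2 * m ^ 2 := by rw [← hq, add_comm]
  have hq1' : q' ^ 2 + 1 = r ^ 2 * m' ^ 2 := by rw [← hq', add_comm]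
  have hr2 : r ^ 2 ≠ 0 := pow_ne_zero 2 hr
  obtain ⟨s, hs, h⟩ := h
  rw [sqDist_stereo_stereo hA (by rw [hq1]; exact mul_ne_zero hr2 (pow_ne_zero 2 hm0))
    (by rw [hq1']; exact mul_ne_zero hr2 (pow_ne_zero 2 hm0')), hq1, hq1'] at h
  have key : (q - q') ^ 2 = (r * (s * m * m' / 2)) ^ 2 := by
    field_simp at h ⊢
    linear_combination h
  have hmem : s * m * m' / 2 ∈ primeField F :=
    div_mem (mul_mem (mul_mem hs hm) hm') (ofNat_mem _ 2)
  obtain ⟨n, hn, hdiff⟩ : ∃ n ∈ primeField F, q - q' = r * n := by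
    rcases sq_eq_sq_iff_eq_or_eq_neg.1 key with h | h
    · exact ⟨_, hmem, h⟩
    · exact ⟨_, neg_mem hmem, by rw [h]; ring⟩
  have hn0 : n ≠ 0 := by
    rintro rfl
    exact sub_ne_zero.2 hqq (by rw [hdiff, mul_zero])
  refine ⟨(n + (m ^ 2 - m' ^ 2) / n) / 2, div_mem (add_mem hn (div_mem (sub_mem (pow_mem hm 2)
    (pow_mem hm' 2)) hn)) (ofNat_mem _ 2), ?_⟩
  have hsum : (q + q') * n = r * (m ^ 2 - m' ^ 2) := by
    apply mul_left_cancel₀ hr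
    linear_combination hq - hq' - (q + q') * hdiff
  field_simp
  linear_combination n * hdiff + hsum

/-- A circular point set through `A` has at most two points or consists of points of rational
slope as seen from `A`. -/
theorem IsCircularPointSet.card_le_two_or_subset (h2 : (2 : F) ≠ 0) (hr : r ≠ 0)
    {S : Set (F × F)} (hS : IsCircularPointSet M r S) (hA : A ∈ S) :
    Cardinal.mk S ≤ 2 ∨ (r ^ 2 ∈ primeField F ∧ S ⊆ slopeSet M A r) := by
  have hAc : A ∈ circleSet M r := hS.2 hA
  by_cases h3 : 3 ≤ Cardinal.mk S
  · right
    have main : ∀ B ∈ S, B ≠ A → ∃ n ∈ primeField F, ∃ m ∈ primeField F, m ≠ 0 ∧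
        1 + r ^ 2 * n ^ 2 = r ^ 2 * m ^ 2 ∧ B = stereo M A (r * n) := by
      intro B hB hBA
      -- The third point `C` is what forces the slope of `B` into `r` times the prime field.
      obtain ⟨⟨C, hC⟩, hCA, hCB⟩ := Cardinal.exists_ne_ne_of_three_le h3 ⟨A, hA⟩ ⟨B, hB⟩
      simp only [ne_eq, Subtype.mk.injEq] at hCA hCB
      obtain ⟨q, hq, rfl⟩ := exists_eq_stereo h2 hr hAc (hS.2 hB) hBA
      obtain ⟨q', hq', rfl⟩ := exists_eq_stereo h2 hr hAc (hS.2 hC) hCA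
      obtain ⟨m, hm, hm0, h⟩ := exists_of_hasRationalSqDist_stereo h2 hr hAc hq (hS.1 _ hA _ hB)
      obtain ⟨m', hm', hm0', h'⟩ :=
        exists_of_hasRationalSqDist_stereo h2 hr hAc hq' (hS.1 _ hA _ hC)
      obtain ⟨n, hn, rfl⟩ := exists_slope_of_hasRationalSqDist h2 hr hAc
        (by rintro rfl; exact hCB rfl) hm hm0 h hm' hm0' h' (hS.1 _ hB _ hC)
      exact ⟨n, hn, m, hm, hm0, by rw [← mul_pow]; exact h, rfl⟩
    constructor
    · obtain ⟨⟨B, hB⟩, hBA, -⟩ := Cardinal.exists_ne_ne_of_three_le h3 ⟨A, hA⟩ ⟨A, hA⟩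
      obtain ⟨n, hn, m, hm, -, h, -⟩ := main B hB (by simpa using hBA)
      have : r ^ 2 = (m ^ 2 - n ^ 2)⁻¹ := by
        apply eq_inv_of_mul_eq_one_left
        linear_combination -h
      rw [this]
      exact inv_mem (sub_mem (pow_mem hm 2) (pow_mem hn 2))
    · intro B hB
      by_cases hBA : B = A
      · exact .inl hBA
      · obtain ⟨n, hn, m, hm, hm0, h, rfl⟩ := main B hB hBA
        exact .inr ⟨⟨n, hn⟩, ⟨⟨m, hm⟩, by simpa [Subtype.ext_iff] using hm0, h⟩, rfl⟩
  · left
    push Not at h3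
    obtain ⟨n, hn⟩ := Cardinal.lt_aleph0.1 (h3.trans (Cardinal.natCast_lt_aleph0 (n := 3)))
    rw [hn] at h3 ⊢
    norm_cast at h3 ⊢
    omega

theorem isCircularPointSet_slopeSet (h2 : (2 : F) ≠ 0) (hr : r ≠ 0) (hA : A ∈ circleSet M r) :
    IsCircularPointSet M r (slopeSet M A r) := by
  constructor
  · apply IsRationalPointSet.insert
    · rintro _ ⟨n, ⟨m, hm0, h⟩, rfl⟩ _ ⟨n', ⟨m', hm0', h'⟩, rfl⟩
      have hm0 : (m : F) ≠ 0 := by simpa using hm0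
      have hm0' : (m' : F) ≠ 0 := by simpa using hm0'
      have e : (r * (n : F)) ^ 2 + 1 = r ^ 2 * (m : F) ^ 2 := by rw [← h]; ring
      have e' : (r * (n' : F)) ^ 2 + 1 = r ^ 2 * (m' : F) ^ 2 := by rw [← h']; ring
      have hr2 : r ^ 2 ≠ 0 := pow_ne_zero 2 hr
      refine ⟨((2 * (n - n') / (m * m') : primeField F) : F), SetLike.coe_mem _, ?_⟩
      rw [sqDist_stereo_stereo hA (by rw [e]; exact mul_ne_zero hr2 (pow_ne_zero 2 hm0))
        (by rw [e']; exact mul_ne_zero hr2 (pow_ne_zero 2 hm0')), e, e']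
      push_cast
      rw [show ((2 : primeField F) : F) = 2 from rfl]
      field_simp
      ring
    · rintro _ ⟨n, ⟨m, hm0, h⟩, rfl⟩
      exact (hasRationalSqDist_stereo h2 hr hA m.2 (by simpa using hm0)
        (by rw [mul_pow]; exact h)).2.1
  · rintro _ (rfl | ⟨n, ⟨m, hm0, h⟩, rfl⟩)
    · exact hA
    · exact (hasRationalSqDist_stereo h2 hr hA m.2 (by simpa using hm0)
        (by rw [mul_pow]; exact h)).1

/-- Coinciding points have squared distance 0, and the distance formula then forces equal slopes;
the extra 1 counts `A`. -/
theorem mk_slopeSet (h2 : (2 : F) ≠ 0) (hr : r ≠ 0) (hA : A ∈ circleSet M r) :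
    Cardinal.mk (slopeSet M A r) = Cardinal.mk (rationalSlopes r) + 1 := by
  rw [slopeSet, Cardinal.mk_insert, Cardinal.mk_image_eq_of_injOn]
  · rintro n ⟨m, hm0, h⟩ n' ⟨m', hm0', h'⟩ heq
    have hm0 : (m : F) ≠ 0 := by simpa using hm0
    have hm0' : (m' : F) ≠ 0 := by simpa using hm0'
    have e : (r * (n : F)) ^ 2 + 1 = r ^ 2 * (m : F) ^ 2 := by rw [← h]; ring
    have e' : (r * (n' : F)) ^ 2 + 1 = r ^ 2 * (m' : F) ^ 2 := by rw [← h']; ring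
    have hr2 : r ^ 2 ≠ 0 := pow_ne_zero 2 hr
    have hd := sqDist_stereo_stereo hA (q := r * n) (q' := r * n')
      (by rw [e]; exact mul_ne_zero hr2 (pow_ne_zero 2 hm0))
      (by rw [e']; exact mul_ne_zero hr2 (pow_ne_zero 2 hm0'))
    dsimp only at heq
    rw [heq, e, e', show sqDist (stereo M A (r * n')) (stereo M A (r * n')) = 0 by simp [sqDist],
      eq_comm] at hd
    have h4 : (4 : F) ≠ 0 := by
      rw [show (4 : F) = 2 * 2 by norm_num]
      exact mul_ne_zero h2 h2
    simp only [div_eq_zero_iff, mul_eq_zero, ne_eq, OfNat.ofNat_ne_zero, not_false_eq_true,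
      pow_eq_zero_iff, h4, hr, hm0, hm0', or_self, or_false, false_or, sub_eq_zero,
      mul_eq_mul_left_iff] at hd
    exact Subtype.ext hd
  · rintro ⟨n, ⟨m, hm0, h⟩, heq⟩
    exact (hasRationalSqDist_stereo h2 hr hA m.2 (by simpa using hm0)
      (by rw [mul_pow]; exact h)).2.2 heq

end Structure

/-! ### Existence of maximal sets -/

theorem IsCircularPointSet.exists_isEMaximal_superset {F : Type*} [Field F] {M : F × F} {r : F}
    {S : Set (F × F)} (hS : IsCircularPointSet M r S) : ∃ T, S ⊆ T ∧ IsEMaximal M r T := by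
  obtain ⟨T, hST, hT⟩ := zorn_subset_nonempty {T | IsCircularPointSet M r T} (by
    intro c hc hchain _
    refine ⟨⋃₀ c, ⟨?_, Set.sUnion_subset fun T hT => (hc hT).2⟩,
      fun T hT => Set.subset_sUnion_of_mem hT⟩
    rintro A ⟨T, hT, hA⟩ B ⟨T', hT', hB⟩
    rcases hchain.total hT hT' with h | h
    · exact (hc hT').1 A (h hA) B hB
    · exact (hc hT).1 A hA B (h hB)) S hS
  exact ⟨T, hST, hT.prop, fun A _ hAT hA =>
    hAT (hT.le_of_ge hA (Set.subset_insert A T) (Set.mem_insert A T))⟩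

/-- Reduces the exact cases to an upper bound for all circular sets and one set attaining it, which
need not be e-maximal. -/
theorem exists_isCMaximal_and_mk_eq {F : Type*} [Field F] {M : F × F} {r : F} {c : Cardinal}
    (hle : ∀ S, IsCircularPointSet M r S → Cardinal.mk S ≤ c)
    (hex : ∃ S, IsCircularPointSet M r S ∧ c ≤ Cardinal.mk S) :
    (∃ S, IsCMaximal M r S) ∧ ∀ S, IsCMaximal M r S → Cardinal.mk S = c := by
  obtain ⟨S, hS, hcS⟩ := hex
  obtain ⟨T, hST, hT⟩ := hS.exists_isEMaximal_superset
  have hcT : c ≤ Cardinal.mk T := hcS.trans (Cardinal.mk_le_mk_of_subset hST)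
  exact ⟨⟨T, hT, fun T' hT' => (hle T' hT'.1).trans hcT⟩,
    fun S hS => (hle S hS.1.1).antisymm (hcT.trans (hS.2 T hT))⟩

theorem exists_isCMaximal_of_forall_mk_le_natCast {F : Type*} [Field F] {M : F × F} {r : F}
    (n : ℕ) (hle : ∀ S, IsCircularPointSet M r S → Cardinal.mk S ≤ n) :
    (∃ S, IsCMaximal M r S) ∧ ∀ S, IsCMaximal M r S → Cardinal.mk S ≤ n := by
  refine ⟨?_, fun S hS => hle S hS.1.1⟩
  let s : Set ℕ := {k | ∃ S, IsCircularPointSet M r S ∧ Cardinal.mk S = k}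
  have hne : s.Nonempty := ⟨1, _, isCircularPointSet_singleton (base_mem_circleSet M r), by simp⟩
  have hbdd : BddAbove s := by
    refine ⟨n, ?_⟩
    rintro k ⟨S, hS, hk⟩
    have := hle S hS
    rw [hk] at this
    exact_mod_cast this
  obtain ⟨S, hS, hk⟩ := Nat.sSup_mem hne hbdd
  refine (exists_isCMaximal_and_mk_eq (c := (sSup s : ℕ)) (fun T hT => ?_) ⟨S, hS, hk.ge⟩).1
  obtain ⟨k, hk'⟩ := Cardinal.lt_aleph0.1 ((hle T hT).trans_lt Cardinal.natCast_lt_aleph0)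
  rw [hk']
  exact_mod_cast le_csSup hbdd ⟨T, hT, hk'⟩

/-! ### Counting points on a hyperbola -/

section Hyperbola

/-- Factor `e = (m - n) * (m + n)` and put `u = m + n`; the excluded `m = 0` corresponds to `u ^ 2 =
-e`. -/
theorem exists_ne_zero_add_eq_sq_iff {k : Type*} [Field k] (h2 : (2 : k) ≠ 0) {e n : k}
    (he : e ≠ 0) :
    (∃ m, m ≠ 0 ∧ n ^ 2 + e = m ^ 2) ↔ ∃ u, u ≠ 0 ∧ u ^ 2 ≠ -e ∧ (u - e / u) / 2 = n := by
  constructor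
  · rintro ⟨m, hm, h⟩
    have hu : m + n ≠ 0 := by
      intro h0
      apply he
      linear_combination h + (m - n) * h0
    refine ⟨m + n, hu, fun h' => ?_, ?_⟩
    · have : 2 * m * (m + n) = 0 := by linear_combination h' - h
      simp_all
    · field_simp
      linear_combination -h
  · rintro ⟨u, hu, hu2, rfl⟩
    refine ⟨(u + e / u) / 2, fun h => hu2 ?_, ?_⟩
    · field_simp at h
      linear_combination h
    · field_simp
      ring

theorem half_sub_div_eq_iff {k : Type*} [Field k] (h2 : (2 : k) ≠ 0) {e u v : k}
    (hu : u ≠ 0) (hv : v ≠ 0) :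
    (u - e / u) / 2 = (v - e / v) / 2 ↔ u = v ∨ u = -e / v := by
  have h : (u - v) * (u * v + e) = 0 ↔ u = v ∨ u = -e / v := by
    rw [mul_eq_zero, sub_eq_zero, eq_div_iff hv, eq_neg_iff_add_eq_zero]
  rw [← h, div_left_inj' h2, ← sub_eq_zero]
  have : (u - v) * (u * v + e) = (u * v) * (u - e / u - (v - e / v)) := by
    field_simp
    ring
  rw [this]
  simp [hu, hv]

theorem two_mul_card_add_eq {k : Type*} [Field k] [Fintype k] [DecidableEq k]
    (h2 : ringChar k ≠ 2) {e : k} (he : e ≠ 0) :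
    (2 * (Nat.card {n : k | ∃ m, m ≠ 0 ∧ n ^ 2 + e = m ^ 2} + 1) : ℤ) + quadraticChar k (-e) =
      Fintype.card k := by
  have h2' : (2 : k) ≠ 0 := Ring.two_ne_zero h2
  let U : Finset k := {u | u ≠ 0 ∧ u ^ 2 ≠ -e}
  let f : k → k := fun u => (u - e / u) / 2
  have hN : {n : k | ∃ m, m ≠ 0 ∧ n ^ 2 + e = m ^ 2} = (U.image f : Finset k) := by
    ext n
    simp [exists_ne_zero_add_eq_sq_iff h2' he, U, f, and_assoc]
  -- Each fibre is `{v, -e / v}`, with two distinct elements since `v ^ 2 ≠ -e`.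
  have hU : U.card = 2 * (U.image f).card := by
    rw [Finset.card_eq_sum_card_image f U, Finset.sum_const_nat (m := 2), mul_comm]
    intro n hn
    obtain ⟨v, hv, rfl⟩ := Finset.mem_image.1 hn
    simp only [U, Finset.mem_filter, Finset.mem_univ, true_and] at hv
    rw [Finset.card_eq_two]
    refine ⟨v, -e / v, fun h => hv.2 ?_, ?_⟩
    · rw [eq_div_iff hv.1] at h
      rw [← h]; ring
    · ext u
      simp only [U, f, Finset.mem_filter, Finset.mem_univ, true_and, Finset.mem_insert,
        Finset.mem_singleton]
      constructor
      · rintro ⟨⟨hu, -⟩, h⟩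
        exact (half_sub_div_eq_iff h2' hu hv.1).1 h
      · intro h
        have hu : u ≠ 0 := by
          rcases h with rfl | rfl
          · exact hv.1
          · exact div_ne_zero (neg_ne_zero.2 he) hv.1
        refine ⟨⟨hu, ?_⟩, (half_sub_div_eq_iff h2' hu hv.1).2 h⟩
        rcases h with rfl | rfl
        · exact hv.2
        · intro h
          apply hv.2
          have hv0 := hv.1
          field_simp at h
          rw [h, neg_neg]
  have hc : U.card + (({x : k | x ^ 2 = -e}.toFinset).card + 1) = Fintype.card k := by
    have h0 : (0 : k) ∉ {x : k | x ^ 2 = -e}.toFinset := by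
      simpa [eq_comm] using he
    rw [← Finset.card_insert_of_notMem h0, ← Finset.card_union_of_disjoint, ← Finset.card_univ]
    · congr 1
      ext u
      simp only [U, Set.toFinset_ofPred, Finset.mem_union, Finset.mem_filter, Finset.mem_univ,
        true_and, Finset.mem_insert, iff_true]
      tauto
    · rw [Finset.disjoint_left]
      simp only [U, Set.toFinset_ofPred, Finset.mem_filter, Finset.mem_univ,
        true_and, Finset.mem_insert]
      tauto
  have hq := quadraticChar_card_sqrts h2 (-e)
  rw [hN, ← hc, hU]
  simp only [SetLike.coe_sort_coe, Nat.card_eq_fintype_card, Fintype.card_coe]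
  push_cast
  linarith

theorem infinite_setOf_exists_add_eq_sq {k : Type*} [Field k] [Infinite k] (h2 : (2 : k) ≠ 0)
    {e : k} (he : e ≠ 0) : {n : k | ∃ m, m ≠ 0 ∧ n ^ 2 + e = m ^ 2}.Infinite := by
  let U : Set k := {u | u ≠ 0 ∧ u ^ 2 ≠ -e}
  have hU : U.Infinite := by
    have hp : (Polynomial.X * (Polynomial.X ^ 2 + Polynomial.C e) : Polynomial k) ≠ 0 :=
      mul_ne_zero Polynomial.X_ne_zero (Polynomial.X_pow_add_C_ne_zero two_pos e)
    refine (Polynomial.finite_setOfPred_isRoot hp).infinite_compl.mono fun u hu => ?_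
    simp only [Set.mem_compl_iff, Set.mem_ofPred_eq, Polynomial.IsRoot.def, Polynomial.eval_mul,
      Polynomial.eval_X, Polynomial.eval_add, Polynomial.eval_pow, Polynomial.eval_C,
      mul_eq_zero, not_or] at hu
    exact ⟨hu.1, fun h => hu.2 (by rw [h]; ring)⟩
  intro hfin
  refine hU (Set.Finite.of_finite_fibers (fun u : k => (u - e / u) / 2)
    (hfin.subset ?_) fun n hn => ?_)
  · rintro _ ⟨u, hu, rfl⟩
    exact (exists_ne_zero_add_eq_sq_iff h2 he).2 ⟨u, hu.1, hu.2, rfl⟩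
  · obtain ⟨v, hv, rfl⟩ := hn
    refine (Set.toFinite {v, -e / v}).subset ?_
    rintro u ⟨hu, h⟩
    exact (half_sub_div_eq_iff h2 hu.1 hv.1).1 h

end Hyperbola

/-! ### The prime field and its squares -/

section PrimeField

variable {F : Type*} [Field F]

theorem natCard_primeField (p : ℕ) [Fact p.Prime] [CharP F p] : Nat.card (primeField F) = p := by
  let _ := ZMod.algebra F p
  have h : (primeField F : Set F) = Set.range (algebraMap (ZMod p) F) := by
    rw [primeField, Subfield.bot_eq_of_zMod_algebra p, RingHom.coe_fieldRange]
  change Nat.card (primeField F : Set F) = p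
  rw [h, Nat.card_congr (Equiv.ofInjective _ (algebraMap (ZMod p) F).injective).symm,
    Nat.card_zmod]

theorem countable_primeField [CharZero F] : Countable (primeField F) := by
  have h : (primeField F : Set F) = Set.range (algebraMap ℚ F) := by
    rw [primeField, Subfield.bot_eq_of_charZero, RingHom.coe_fieldRange]
  change Countable (primeField F : Set F)
  rw [h]
  exact (Set.countable_range _).to_subtype

theorem rationalSlopes_eq {r : F} (hr : r ≠ 0) {d : primeField F} (hd : (d : F) = r ^ 2) :
    rationalSlopes r = {n | ∃ m, m ≠ 0 ∧ n ^ 2 + d⁻¹ = m ^ 2} := by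
  have hr2 : r ^ 2 ≠ 0 := pow_ne_zero 2 hr
  ext n
  refine exists_congr fun m => and_congr_right fun _ => ?_
  rw [Subtype.ext_iff]
  push_cast
  rw [hd]
  field_simp
  rw [add_comm, mul_comm]

theorem isSquare_iff_mem_primeField {r : F} {d : primeField F} (hd : (d : F) = r ^ 2) :
    IsSquare d ↔ r ∈ primeField F := by
  constructor
  · rintro ⟨s, rfl⟩
    have : r ^ 2 = (s : F) ^ 2 := by rw [← hd]; push_cast; ring
    rcases sq_eq_sq_iff_eq_or_eq_neg.1 this with h | h
    · exact h ▸ s.2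
    · exact h ▸ neg_mem s.2
  · intro h
    exact ⟨⟨r, h⟩, Subtype.ext (by push_cast; rw [hd, sq])⟩

theorem isSquare_neg_one_iff_exists_primeField :
    IsSquare (-1 : primeField F) ↔ ∃ t ∈ primeField F, t ^ 2 + 1 = 0 := by
  constructor
  · rintro ⟨s, h⟩
    refine ⟨s, s.2, ?_⟩
    have := congrArg (Subtype.val) h
    push_cast at this
    linear_combination -this
  · rintro ⟨t, ht, h⟩
    refine ⟨⟨t, ht⟩, Subtype.ext ?_⟩
    push_cast
    linear_combination -h

end PrimeField

theorem quadraticChar_inv {k : Type*} [Field k] [Fintype k] [DecidableEq k] (d : k) :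
    quadraticChar k d⁻¹ = quadraticChar k d := by
  by_cases hd : d = 0
  · simp [hd]
  · have h : quadraticChar k d⁻¹ = quadraticChar k (d * (d⁻¹) ^ 2) := by
      congr 1
      field_simp
    rw [h, map_mul, quadraticChar_sq_one' (inv_ne_zero hd), mul_one]

/-! ### Size of the slope set -/

section Cardinality

variable {F : Type*} [Field F] {M A : F × F} {r : F}

theorem mk_slopeSet_eq_aleph0 [CharZero F] (hr : r ≠ 0) (hr2 : r ^ 2 ∈ primeField F)
    (hA : A ∈ circleSet M r) : Cardinal.mk (slopeSet M A r) = Cardinal.aleph0 := by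
  have := countable_primeField (F := F)
  rw [mk_slopeSet two_ne_zero hr hA, rationalSlopes_eq hr (d := ⟨_, hr2⟩) rfl]
  have hinf := infinite_setOf_exists_add_eq_sq (k := primeField F) two_ne_zero
    (e := (⟨r ^ 2, hr2⟩ : primeField F)⁻¹)
    (inv_ne_zero (by simpa [Subtype.ext_iff] using hr))
  have := hinf.to_subtype
  rw [Cardinal.mk_eq_aleph0, Cardinal.add_one_eq le_rfl]

/-- The number of points of `slopeSet M A r`, up to a factor of two and the value of the quadratic
character at `-r²`. -/
theorem exists_mk_slopeSet_eq (p : ℕ) [Fact p.Prime] [CharP F p] (hp : p ≠ 2) (hr : r ≠ 0)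
    (hr2 : r ^ 2 ∈ primeField F) (hA : A ∈ circleSet M r) :
    ∃ N : ℕ, Cardinal.mk (slopeSet M A r) = N ∧
      (((∃ t ∈ primeField F, t ^ 2 + 1 = 0) ↔ r ∈ primeField F) → 2 * N + 1 = p) ∧
      (¬ ((∃ t ∈ primeField F, t ^ 2 + 1 = 0) ↔ r ∈ primeField F) → 2 * N = p + 1) := by
  classical
  have hcard := natCard_primeField (F := F) p
  have : Finite (primeField F) :=
    Nat.finite_of_card_ne_zero (by rw [hcard]; exact (Fact.out : p.Prime).ne_zero)
  have := Fintype.ofFinite (primeField F)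
  have hchar : ringChar F = p := ringChar.eq F p
  have h2 : (2 : F) ≠ 0 := Ring.two_ne_zero (by rw [hchar]; exact hp)
  have hchar' : ringChar (primeField F) ≠ 2 := by
    intro h
    have := ringChar.Nat.cast_ringChar (R := primeField F)
    rw [h] at this
    exact h2 (congrArg Subtype.val this)
  set d : primeField F := ⟨r ^ 2, hr2⟩ with hd
  have hd0 : d ≠ 0 := by simpa [hd, Subtype.ext_iff] using hr
  have hcount := two_mul_card_add_eq hchar' (inv_ne_zero hd0)
  -- The character at `-d⁻¹` becomes `χ(-1) * χ(d)`, which is 1 exactly when `-1` and `d` are both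
  -- squares or both nonsquares.
  rw [← rationalSlopes_eq hr (d := d) rfl, ← Nat.card_eq_fintype_card, hcard, ← neg_one_mul,
    map_mul, quadraticChar_inv] at hcount
  refine ⟨Nat.card (rationalSlopes r) + 1, ?_, ?_, ?_⟩
  · rw [mk_slopeSet h2 hr hA]
    push_cast
    rw [Nat.cast_card]
  all_goals
    intro h
    rw [← isSquare_neg_one_iff_exists_primeField, ← isSquare_iff_mem_primeField (d := d) rfl] at h
    have h1 := quadraticChar_dichotomy (neg_ne_zero.2 (one_ne_zero (α := primeField F)))
    have h3 := quadraticChar_dichotomy hd0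
    rw [← quadraticChar_one_iff_isSquare (neg_ne_zero.2 (one_ne_zero (α := primeField F))),
      ← quadraticChar_one_iff_isSquare hd0] at h
    rcases h1 with h1 | h1 <;> rcases h3 with h3 | h3 <;> rw [h1, h3] at h hcount <;>
      omega

/-! ### Maximal cardinality by characteristic -/

theorem IsCircularPointSet.mk_le (h2 : (2 : F) ≠ 0) (hr : r ≠ 0) {S : Set (F × F)}
    {c : Cardinal} (hc : 2 ≤ c) (hS : IsCircularPointSet M r S)
    (hslope : r ^ 2 ∈ primeField F → ∀ A ∈ circleSet M r, Cardinal.mk (slopeSet M A r) ≤ c) :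
    Cardinal.mk S ≤ c := by
  rcases S.eq_empty_or_nonempty with rfl | ⟨A, hA⟩
  · simp
  · rcases hS.card_le_two_or_subset h2 hr hA with h | ⟨hr2, h⟩
    · exact h.trans hc
    · exact (Cardinal.mk_le_mk_of_subset h).trans (hslope hr2 A (hS.2 hA))

theorem exists_isCMaximal_and_mk_eq_of_mk_slopeSet (h2 : (2 : F) ≠ 0) (hr : r ≠ 0)
    {c : Cardinal} (hc : 2 ≤ c)
    (hslope : ∀ A ∈ circleSet M r, Cardinal.mk (slopeSet M A r) = c) :
    (∃ S, IsCMaximal M r S) ∧ ∀ S, IsCMaximal M r S → Cardinal.mk S = c :=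
  exists_isCMaximal_and_mk_eq
    (fun _ hS => hS.mk_le h2 hr hc fun _ A hA => (hslope A hA).le)
    ⟨_, isCircularPointSet_slopeSet h2 hr (base_mem_circleSet M r),
      (hslope _ (base_mem_circleSet M r)).ge⟩

theorem exists_isCMaximal_of_sq_notMem (h2 : (2 : F) ≠ 0) (hr : r ≠ 0)
    (hr2 : r ^ 2 ∉ primeField F) :
    (∃ S, IsCMaximal M r S) ∧ ∀ S, IsCMaximal M r S → Cardinal.mk S ≤ 2 := by
  have := exists_isCMaximal_of_forall_mk_le_natCast (M := M) (r := r) 2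
    fun S hS => hS.mk_le h2 hr (by norm_num) fun h => absurd h hr2
  simpa using this

theorem hasRationalSqDist_of_ringChar_eq_two (h : ringChar F = 2) {B : F × F}
    (hA : A ∈ circleSet M r) (hB : B ∈ circleSet M r) : HasRationalSqDist A B := by
  have : CharP F 2 := ringChar.of_eq h
  have h2 : (2 : F) = 0 := CharTwo.two_eq_zero
  rw [mem_circleSet] at hA hB
  refine ⟨0, zero_mem _, ?_⟩
  rw [sqDist]
  linear_combination hA + hB + (r ^ 2 - (A.1 - M.1) * (B.1 - M.1) - (A.2 - M.2) * (B.2 - M.2)) * h2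

theorem mk_circleSet_of_ringChar_eq_two (h : ringChar F = 2) (M : F × F) (r : F) :
    Cardinal.mk (circleSet M r) = Cardinal.mk F := by
  have : CharP F 2 := ringChar.of_eq h
  have h2 : (2 : F) = 0 := CharTwo.two_eq_zero
  -- In characteristic 2 the circle equation is the square of a linear equation.
  have heq : circleSet M r = Set.range fun x : F => (x, M.2 + r + (x - M.1)) := by
    ext ⟨x, y⟩
    simp only [mem_circleSet, Set.mem_range, Prod.mk.injEq, exists_eq_left]
    constructor
    · intro hxy
      have : (y - (M.2 + r + (x - M.1))) ^ 2 = 0 := by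
        linear_combination hxy + (r ^ 2 - (y - M.2) * (r + (x - M.1)) + r * (x - M.1)) * h2
      exact (sub_eq_zero.1 (pow_eq_zero_iff two_ne_zero |>.1 this)).symm
    · rintro rfl
      linear_combination ((x - M.1) ^ 2 + r * (x - M.1)) * h2
  rw [heq, Cardinal.mk_range_eq]
  intro x y hxy
  exact congrArg Prod.fst hxy

theorem exists_isCMaximal_of_ringChar_eq_two (h : ringChar F = 2) :
    (∃ S, IsCMaximal M r S) ∧ ∀ S, IsCMaximal M r S → Cardinal.mk S = Cardinal.mk F := by
  rw [← mk_circleSet_of_ringChar_eq_two h M r]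
  exact exists_isCMaximal_and_mk_eq (fun S hS => Cardinal.mk_le_mk_of_subset hS.2)
    ⟨_, ⟨fun A hA B hB => hasRationalSqDist_of_ringChar_eq_two h hA hB, subset_rfl⟩, le_rfl⟩

theorem exists_isCMaximal_of_ringChar_eq_three (h : ringChar F = 3) (hr : r ≠ 0)
    (hr2 : r ^ 2 ∈ primeField F) :
    (∃ S, IsCMaximal M r S) ∧ ∀ S, IsCMaximal M r S → Cardinal.mk S = 2 := by
  have : CharP F 3 := ringChar.of_eq h
  have : Fact (Nat.Prime 3) := ⟨Nat.prime_three⟩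
  have h3 : (3 : F) = 0 := by exact_mod_cast CharP.cast_eq_zero F 3
  have h2 : (2 : F) ≠ 0 := Ring.two_ne_zero (by rw [h]; norm_num)
  have hA := base_mem_circleSet M r
  refine exists_isCMaximal_and_mk_eq
    (fun S hS => hS.mk_le h2 hr le_rfl fun _ A hA => ?_) ?_
  · obtain ⟨N, hN, h1, h1'⟩ := exists_mk_slopeSet_eq 3 (by norm_num) hr hr2 hA
    rw [hN]
    have : N ≤ 2 := by
      by_cases hc : (∃ t ∈ primeField F, t ^ 2 + 1 = 0) ↔ r ∈ primeField F
      · have := h1 hc; omega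
      · have := h1' hc; omega
    exact_mod_cast this
  · obtain ⟨q, hq⟩ : ∃ q : F, ∃ m ∈ primeField F, m ≠ 0 ∧ 1 + q ^ 2 = r ^ 2 * m ^ 2 := by
      by_cases hrm : r ∈ primeField F
      · exact ⟨0, r⁻¹, inv_mem hrm, inv_ne_zero hr, by field_simp; ring⟩
      · refine ⟨1, 1, one_mem _, one_ne_zero, ?_⟩
        have hcard := natCard_primeField (F := F) 3
        have : Finite (primeField F) := Nat.finite_of_card_ne_zero (by rw [hcard]; norm_num)
        have := Fintype.ofFinite (primeField F)
        have hd : (r ^ 2) ^ 3 = r ^ 2 := by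
          have := FiniteField.pow_card (⟨r ^ 2, hr2⟩ : primeField F)
          rw [← Nat.card_eq_fintype_card, hcard] at this
          exact congrArg Subtype.val this
        have hd' : (r - 1) * (r + 1) * (r ^ 2 + 1) = 0 := by
          apply mul_left_cancel₀ (pow_ne_zero 2 hr)
          linear_combination hd
        rcases mul_eq_zero.1 hd' with hd' | hd'
        · rcases mul_eq_zero.1 hd' with hd' | hd'
          · exact absurd (sub_eq_zero.1 hd' ▸ one_mem _) hrm
          · exact absurd (eq_neg_of_add_eq_zero_left hd' ▸ neg_mem (one_mem _)) hrm
        · linear_combination h3 - hd'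
    obtain ⟨m, hm, hm0, hq⟩ := hq
    obtain ⟨hB, hAB, hne⟩ := hasRationalSqDist_stereo h2 hr hA hm hm0 hq
    refine ⟨{stereo M (M.1 + r, M.2) q, (M.1 + r, M.2)}, ⟨?_, ?_⟩, ?_⟩
    · refine (isCircularPointSet_singleton hA).1.insert ?_
      rintro B rfl
      exact hAB.symm
    · exact Set.insert_subset hB (by simpa using hA)
    · rw [Cardinal.mk_insert (by simpa using hne), Cardinal.mk_singleton]
      norm_num

theorem exists_isCMaximal_of_three_lt_ringChar (h : 3 < ringChar F) (hr : r ≠ 0)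
    (hr2 : r ^ 2 ∈ primeField F) :
    (∃ S, IsCMaximal M r S) ∧ ∀ S, IsCMaximal M r S → ∃ N : ℕ, Cardinal.mk S = N ∧
      (((∃ t ∈ primeField F, t ^ 2 + 1 = 0) ↔ r ∈ primeField F) → N = (ringChar F - 1) / 2) ∧
      (¬ ((∃ t ∈ primeField F, t ^ 2 + 1 = 0) ↔ r ∈ primeField F) →
        N = (ringChar F + 1) / 2) := by
  have h2 : (2 : F) ≠ 0 := Ring.two_ne_zero (by omega)
  have hp : Fact (ringChar F).Prime :=
    ⟨(CharP.char_is_prime_or_zero F (ringChar F)).resolve_right (by omega)⟩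
  have hodd := hp.out.eq_two_or_odd
  by_cases hc : (∃ t ∈ primeField F, t ^ 2 + 1 = 0) ↔ r ∈ primeField F
  -- Pairs of irrational slope do not exceed the slope set because `p ≥ 5`; this fails for `p = 3`.
  · have h2c : 2 ≤ (ringChar F - 1) / 2 := by omega
    obtain ⟨hex, hS⟩ := exists_isCMaximal_and_mk_eq_of_mk_slopeSet (M := M) (r := r)
      (c := ((ringChar F - 1) / 2 : ℕ)) h2 hr (by exact_mod_cast h2c) fun A hA => by
        obtain ⟨N, hN, h1, h1'⟩ := exists_mk_slopeSet_eq (ringChar F) (by omega) hr hr2 hA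
        have := h1 hc
        rw [hN, show N = (ringChar F - 1) / 2 by omega]
    exact ⟨hex, fun S h => ⟨_, hS S h, fun _ => rfl, fun h => absurd hc h⟩⟩
  · have h2c : 2 ≤ (ringChar F + 1) / 2 := by omega
    obtain ⟨hex, hS⟩ := exists_isCMaximal_and_mk_eq_of_mk_slopeSet (M := M) (r := r)
      (c := ((ringChar F + 1) / 2 : ℕ)) h2 hr (by exact_mod_cast h2c) fun A hA => by
        obtain ⟨N, hN, h1, h1'⟩ := exists_mk_slopeSet_eq (ringChar F) (by omega) hr hr2 hA
        have := h1' hc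
        rw [hN, show N = (ringChar F + 1) / 2 by omega]
    exact ⟨hex, fun S h => ⟨_, hS S h, fun h => absurd h hc, fun _ => rfl⟩⟩

theorem exists_isCMaximal_of_ringChar_eq_zero (h : ringChar F = 0) (hr : r ≠ 0)
    (hr2 : r ^ 2 ∈ primeField F) :
    (∃ S, IsCMaximal M r S) ∧ ∀ S, IsCMaximal M r S → Cardinal.mk S = Cardinal.aleph0 := by
  have : CharP F 0 := ringChar.of_eq h
  have : CharZero F := CharP.charP_to_charZero F
  exact exists_isCMaximal_and_mk_eq_of_mk_slopeSet two_ne_zero hr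
    (Cardinal.natCast_lt_aleph0 (n := 2)).le fun A hA => mk_slopeSet_eq_aleph0 hr hr2 hA

end Cardinality

theorem mainTheorem1 {F : Type*} [Field F] (M : F × F) (r : F) (hr : r ≠ 0) :
    (∃ S : Set (F × F), IsCMaximal M r S) ∧
    ∀ S : Set (F × F), IsCMaximal M r S →
      -- characteristic 2
      (ringChar F = 2 → Cardinal.mk S = Cardinal.mk F) ∧
      -- characteristic 3
      (ringChar F = 3 →
        (r ∈ primeField F → Cardinal.mk S = 2) ∧
        (r ^ 2 ∈ primeField F → r ∉ primeField F → Cardinal.mk S = 2) ∧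
        (r ^ 2 ∉ primeField F → Cardinal.mk S ≤ 2)) ∧
      -- finite characteristic greater than 3 (hence odd, so both quotients are exact)
      (3 < ringChar F →
        ((¬ ∃ t ∈ primeField F, t ^ 2 + 1 = 0) →
          (r ∈ primeField F →
            Cardinal.mk S = (((ringChar F + 1) / 2 : ℕ) : Cardinal)) ∧
          (r ^ 2 ∈ primeField F → r ∉ primeField F →
            Cardinal.mk S = (((ringChar F - 1) / 2 : ℕ) : Cardinal)) ∧
          (r ^ 2 ∉ primeField F → Cardinal.mk S ≤ 2)) ∧
        ((∃ t ∈ primeField F, t ^ 2 + 1 = 0) →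
          (r ∈ primeField F →
            Cardinal.mk S = (((ringChar F - 1) / 2 : ℕ) : Cardinal)) ∧
          (r ^ 2 ∈ primeField F → r ∉ primeField F →
            Cardinal.mk S = (((ringChar F + 1) / 2 : ℕ) : Cardinal)) ∧
          (r ^ 2 ∉ primeField F → Cardinal.mk S ≤ 2))) ∧
      -- characteristic 0
      (ringChar F = 0 →
        (r ∈ primeField F → Cardinal.mk S = Cardinal.aleph0) ∧
        (r ^ 2 ∈ primeField F → r ∉ primeField F → Cardinal.mk S = Cardinal.aleph0) ∧
        (r ^ 2 ∉ primeField F → Cardinal.mk S ≤ 2)) := by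
  have h2 (h : ringChar F ≠ 2) : (2 : F) ≠ 0 := Ring.two_ne_zero h
  by_cases hc2 : ringChar F = 2
  · obtain ⟨hex, hS⟩ := exists_isCMaximal_of_ringChar_eq_two (M := M) (r := r) hc2
    exact ⟨hex, fun S h => ⟨fun _ => hS S h, by simp [hc2], by simp [hc2], by simp [hc2]⟩⟩
  by_cases hr2 : r ^ 2 ∈ primeField F
  swap
  · have hrm : r ∉ primeField F := fun h => hr2 (pow_mem h 2)
    obtain ⟨hex, hS⟩ := exists_isCMaximal_of_sq_notMem (M := M) (h2 hc2) hr hr2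
    refine ⟨hex, fun S h => ?_⟩
    simp [hc2, hr2, hrm, hS S h]
  by_cases hc3 : ringChar F = 3
  · obtain ⟨hex, hS⟩ := exists_isCMaximal_of_ringChar_eq_three (M := M) hc3 hr hr2
    refine ⟨hex, fun S h => ?_⟩
    simp [hc3, hS S h]
  by_cases hc0 : ringChar F = 0
  · obtain ⟨hex, hS⟩ := exists_isCMaximal_of_ringChar_eq_zero (M := M) hc0 hr hr2
    refine ⟨hex, fun S h => ?_⟩
    simp [hc0, hr2, hS S h]
  have hc1 : ringChar F ≠ 1 := CharP.ringChar_ne_one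
  obtain ⟨hex, hS⟩ := exists_isCMaximal_of_three_lt_ringChar (M := M) (by omega) hr hr2
  refine ⟨hex, fun S h => ⟨fun h => absurd h hc2, fun h => absurd h hc3, fun _ => ?_,
    fun h => absurd h hc0⟩⟩
  obtain ⟨N, hN, h1, h1'⟩ := hS S h
  rw [hN]
  refine ⟨fun ht => ⟨fun hrm => ?_, fun _ hrm => ?_, fun h => absurd hr2 h⟩,
    fun ht => ⟨fun hrm => ?_, fun _ hrm => ?_, fun h => absurd hr2 h⟩⟩
  · rw [h1' fun e => ht (e.2 hrm)]
  · rw [h1 (iff_of_false ht hrm)]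
  · rw [h1 (iff_of_true ht hrm)]
  · rw [h1' fun e => hrm (e.1 ht)]
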